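/- Let $n\ge 0$ and $\gamma\ge 1$ be integers, $[n]=\{1,\dots,n\}$, $u_0>0$ and $u_1,\dots,u_n\ge 0$ reals. For $\mathcal S\subseteq[n]$ put $u(\mathcal S)=\sum_{j\in\mathcal S}u_j$, $$\Phi(\mathcal S)=\max\Big\{\tfrac{u(\mathcal S')}{u(\mathcal S')+u_0}:\mathcal S'\subseteq\mathcal S,\ |\mathcal S'|\le\gamma\Big\},\qquad \rho_j(\mathcal S)=\Phi(\mathcal S\cup\{j\})-\Phi(\mathcal S).$$ Let $$\phi(x)=\max\Big\{\tfrac{\sum_{j}u_jy_j}{\sum_{j}u_jy_j+u_0}:\ \textstyle\sum_j y_j\le\gamma,\ y_j\le x_j,\ y_j\in[0,1]\ \forall j\in[n]\Big\},\qquad \mathcal X=\{(w,x)\in\mathbb R\times\{0,1\}^n: w\le\phi(x)\},$$ and, for disjoint $\mathcal S_0,\mathcal S_1\subseteq[n]$, let $\mathcal X(\mathcal S_0,\mathcal S_1)$ be the set of $(w,x)\in\mathcal X$ with $x_j=0$ for $j\in\mathcal S_0$ and $x_j=1$ for $j\in\mathcal S_1$. Fix $\mathcal S\subseteq[n]$ and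 let $s=|\mathcal S|$. (1) For every ordering $j_1,\dots,j_s$ of $\mathcal S$, the lifting coefficients $\eta_j$, $j\in\mathcal S$, are well defined (all maxima are attained) by $$\eta_{j_\ell}=\Phi(\mathcal S)-\sum_{\tau<\ell}\eta_{j_\tau}-\max\Big\{w-\sum_{j\in[n]\setminus\mathcal S}\rho_j(\mathcal S)x_j-\sum_{\tau<\ell}\eta_{j_\tau}x_{j_\tau}:(w,x)\in\mathcal X(\{j_\ell\},\{j_{\ell+1},\dots,j_s\})\Big\},\quad \ell=1,\dots,s.$$ They satisfy $\eta_j\ge\rho_j([n]\setminus\{j\})$ for all $j\in\mathcal S$, and the lifted submodular inequality $$w\le\Phi(\mathcal S)+\sum_{j\in[n]\setminus\mathcal S}\rho_j(\mathcal S)x_j-\sum_{j\in\mathcal S}\eta_j(1-x_j)$$ is at least as strong as the submodular inequality $$w\le\Phi(\mathcal S)+\sum_{j\in[n]\setminus\mathcal S}\rho_j(\mathcal S)x_j-\sum_{j\in\mathcal S}\rho_j([n]\setminus\{j\})(1-x_j),$$ that is, every $(w,x)\in\mathbb R\times[0,1]^n$ satisfying the former satisfies the latter. (2) For every ordering $j_1,\dots,j_{n-s}$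 of $[n]\setminus\mathcal S$, the lifting coefficients $\zeta_j$, $j\in[n]\setminus\mathcal S$, are well defined (all maxima are attained) by $$\zeta_{j_\ell}=-\Phi(\mathcal S)+\sum_{j\in\mathcal S}\rho_j(\mathcal S\setminus\{j\})+\max\Big\{w-\sum_{j\in\mathcal S}\rho_j(\mathcal S\setminus\{j\})x_j-\sum_{\tau<\ell}\zeta_{j_\tau}x_{j_\tau}:(w,x)\in\mathcal X(\{j_{\ell+1},\dots,j_{n-s}\},\{j_\ell\})\Big\},\quad \ell=1,\dots,n-s.$$ They satisfy $\zeta_j\le\rho_j(\varnothing)$ for all $j\in[n]\setminus\mathcal S$, and the lifted submodular inequality $$w\le\Phi(\mathcal S)-\sum_{j\in\mathcal S}\rho_j(\mathcal S\setminus\{j\})(1-x_j)+\sum_{j\in[n]\setminus\mathcal S}\zeta_jx_j$$ is at least as strong, in the same sense, as the submodular inequality $$w\le\Phi(\mathcal S)+\sum_{j\in[n]\setminus\mathcal S}\rho_j(\varnothing)x_j-\sum_{j\in\mathcal S}\rho_j(\mathcal S\setminus\{j\})(1-x_j).$$ -/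

import Mathlib

namespace LiftedSubmodular

noncomputable section

/-- The value `u(A) / (u(A) + u₀)` of a finite set `A` of facilities. -/
def share {n : ℕ} (u₀ : ℝ) (u : Fin n → ℝ) (A : Finset (Fin n)) : ℝ :=
  (∑ j ∈ A, u j) / ((∑ j ∈ A, u j) + u₀)

/-- The set function `Φ(S) = max { u(A) / (u(A) + u₀) : A ⊆ S, |A| ≤ γ }`. -/
def Phi {n : ℕ} (u₀ : ℝ) (u : Fin n → ℝ) (γ : ℕ) (S : Finset (Fin n)) : ℝ :=
  (S.powerset.filter fun A => A.card ≤ γ).sup'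
    ⟨∅, by simp⟩ (share u₀ u)

/-- The marginal gain `ρ_j(S) = Φ(S ∪ j) - Φ(S)`. -/
def rho {n : ℕ} (u₀ : ℝ) (u : Fin n → ℝ) (γ : ℕ) (j : Fin n) (S : Finset (Fin n)) : ℝ :=
  Phi u₀ u γ (insert j S) - Phi u₀ u γ S

/-- The function `φ(x)`: the maximum of `(∑ u_j y_j) / (∑ u_j y_j + u₀)` over all `y ∈ [0,1]^n`
with `∑ y_j ≤ γ` and `y_j ≤ x_j` for all `j`. (For `x ≥ 0`, `u ≥ 0`, `u₀ > 0` the feasible region is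
nonempty and compact, so that the supremum is a maximum.) -/
def phi {n : ℕ} (u₀ : ℝ) (u : Fin n → ℝ) (γ : ℕ) (x : Fin n → ℝ) : ℝ :=
  sSup {r : ℝ | ∃ y : Fin n → ℝ,
    (∑ j, y j ≤ (γ : ℝ)) ∧ (∀ j, y j ≤ x j) ∧ (∀ j, y j ∈ Set.Icc (0 : ℝ) 1) ∧
    r = (∑ j, u j * y j) / ((∑ j, u j * y j) + u₀)}

/-- The mixed 0-1 set `𝒳 = {(w, x) ∈ ℝ × {0,1}^n : w ≤ φ(x)}`. -/
def X {n : ℕ} (u₀ : ℝ) (u : Fin n → ℝ) (γ : ℕ) : Set (ℝ × (Fin n → ℝ)) :=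
  {p | (∀ j, p.2 j = 0 ∨ p.2 j = 1) ∧ p.1 ≤ phi u₀ u γ p.2}

/-- The restriction `𝒳(S₀, S₁)`: variables in `S₀` are fixed to `0`, those in `S₁` to `1`. -/
def XFix {n : ℕ} (u₀ : ℝ) (u : Fin n → ℝ) (γ : ℕ) (S₀ S₁ : Finset (Fin n)) :
    Set (ℝ × (Fin n → ℝ)) :=
  {p | p ∈ X u₀ u γ ∧ (∀ j ∈ S₀, p.2 j = 0) ∧ (∀ j ∈ S₁, p.2 j = 1)}

/-- `η` is the family of coefficients obtained by down-lifting the variables of `S`, in the order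
`σ 0, σ 1, …`, into the seed inequality `w ≤ Φ(S) + ∑_{j ∉ S} ρ_j(S) x_j`: for each position `ℓ`,
the lifting problem attains its maximum `ν` and `η_{σ ℓ} = Φ(S) - ∑_{τ < ℓ} η_{σ τ} - ν`. -/
def IsDownLifting {n : ℕ} (u₀ : ℝ) (u : Fin n → ℝ) (γ : ℕ) (S : Finset (Fin n))
    (σ : Fin S.card ≃ ↥S) (η : ↥S → ℝ) : Prop :=
  ∀ ℓ : Fin S.card, ∃ ν : ℝ,
    IsGreatest
      ((fun p : ℝ × (Fin n → ℝ) =>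
          p.1 - ∑ j ∈ Sᶜ, rho u₀ u γ j S * p.2 j
            - ∑ τ ∈ Finset.Iio ℓ, η (σ τ) * p.2 (σ τ)) ''
        XFix u₀ u γ {(σ ℓ : Fin n)} ((Finset.Ioi ℓ).image fun τ => (σ τ : Fin n))) ν ∧
    η (σ ℓ) = Phi u₀ u γ S - ∑ τ ∈ Finset.Iio ℓ, η (σ τ) - ν

/-- `ζ` is the family of coefficients obtained by up-lifting the variables outside `S`, in the order
`σ 0, σ 1, …`, into the seed inequality `w ≤ Φ(S) - ∑_{j ∈ S} ρ_j(S \ j) (1 - x_j)`: for each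
position `ℓ`, the lifting problem attains its maximum `ν` and
`ζ_{σ ℓ} = -Φ(S) + ∑_{j ∈ S} ρ_j(S \ j) + ν`. -/
def IsUpLifting {n : ℕ} (u₀ : ℝ) (u : Fin n → ℝ) (γ : ℕ) (S : Finset (Fin n))
    (σ : Fin (Sᶜ).card ≃ ↥(Sᶜ)) (ζ : ↥(Sᶜ) → ℝ) : Prop :=
  ∀ ℓ : Fin (Sᶜ).card, ∃ ν : ℝ,
    IsGreatest
      ((fun p : ℝ × (Fin n → ℝ) =>
          p.1 - ∑ j ∈ S, rho u₀ u γ j (S.erase j) * p.2 j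
            - ∑ τ ∈ Finset.Iio ℓ, ζ (σ τ) * p.2 (σ τ)) ''
        XFix u₀ u γ ((Finset.Ioi ℓ).image fun τ => (σ τ : Fin n)) {(σ ℓ : Fin n)}) ν ∧
    ζ (σ ℓ) = -Phi u₀ u γ S + ∑ j ∈ S, rho u₀ u γ j (S.erase j) + ν

/-- The first submodular inequality defined by `S`, at the point `(w, x)`. -/
def SI1 {n : ℕ} (u₀ : ℝ) (u : Fin n → ℝ) (γ : ℕ) (S : Finset (Fin n))
    (w : ℝ) (x : Fin n → ℝ) : Prop :=
  w ≤ Phi u₀ u γ S + ∑ j ∈ Sᶜ, rho u₀ u γ j S * x j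
    - ∑ j ∈ S, rho u₀ u γ j (Finset.univ.erase j) * (1 - x j)

/-- The second submodular inequality defined by `S`, at the point `(w, x)`. -/
def SI2 {n : ℕ} (u₀ : ℝ) (u : Fin n → ℝ) (γ : ℕ) (S : Finset (Fin n))
    (w : ℝ) (x : Fin n → ℝ) : Prop :=
  w ≤ Phi u₀ u γ S + ∑ j ∈ Sᶜ, rho u₀ u γ j ∅ * x j
    - ∑ j ∈ S, rho u₀ u γ j (S.erase j) * (1 - x j)

/-- The first lifted submodular inequality, with lifting coefficients `η`. -/
def LiftedSI1 {n : ℕ} (u₀ : ℝ) (u : Fin n → ℝ) (γ : ℕ) (S : Finset (Fin n)) (η : ↥S → ℝ)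
    (w : ℝ) (x : Fin n → ℝ) : Prop :=
  w ≤ Phi u₀ u γ S + ∑ j ∈ Sᶜ, rho u₀ u γ j S * x j - ∑ j : ↥S, η j * (1 - x j)

/-- The second lifted submodular inequality, with lifting coefficients `ζ`. -/
def LiftedSI2 {n : ℕ} (u₀ : ℝ) (u : Fin n → ℝ) (γ : ℕ) (S : Finset (Fin n)) (ζ : ↥(Sᶜ) → ℝ)
    (w : ℝ) (x : Fin n → ℝ) : Prop :=
  w ≤ Phi u₀ u γ S - ∑ j ∈ S, rho u₀ u γ j (S.erase j) * (1 - x j) + ∑ j : ↥(Sᶜ), ζ j * x j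

/-- The inequality `P` is at least as strong as the inequality `Q`: every point of
`ℝ × [0,1]^n` that satisfies `P` satisfies `Q`. -/
def AtLeastAsStrong {n : ℕ} (P Q : ℝ → (Fin n → ℝ) → Prop) : Prop :=
  ∀ (w : ℝ) (x : Fin n → ℝ), (∀ j, x j ∈ Set.Icc (0 : ℝ) 1) → P w x → Q w x

end

end LiftedSubmodular

namespace LiftedSubmodular

open Finset

/-! The set function `Φ` is the increasing concave map `t ↦ t / (t + u₀)` applied to `maxWeight`,
which is submodular by an exchange argument. Concavity and monotonicity make `Φ` submodular
(`rho_anti`). At 0-1 points `phi` agrees with `Φ` (`phi_incidence`), so every lifting problem is a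
maximum over finitely many sets `T`. As each problem involves only earlier coefficients, the
recursion has exactly one solution.

The lifted inequality holds at every `T`: if `T` agrees with the seed's fixings, it is the seed
inequality, a consequence of submodularity; otherwise take the last position `ℓ` where `T` departs
from them, and the inequality says that `T` does not beat the optimum of problem `ℓ`.

For the bounds on coefficients, let `T` be optimal in problem `ℓ` and flip element `σ ℓ`. Validity
at the flipped set, compared with the optimal value at `T`, bounds the coefficient by a marginal
gain of `σ ℓ`; `rho_anti` then moves that gain to the extreme set. Strength follows termwise on the
unit box. -/

/-- The largest weight `u(A)` of a set `A ⊆ S` with at most `γ` elements. -/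
noncomputable def maxWeight {n : ℕ} (u : Fin n → ℝ) (γ : ℕ) (S : Finset (Fin n)) : ℝ :=
  (S.powerset.filter fun A => A.card ≤ γ).sup' ⟨∅, by simp⟩ fun A => ∑ j ∈ A, u j

/-! ### Maximal weight under a cardinality bound -/

section MaxWeight

variable {n : ℕ} {u : Fin n → ℝ} {γ : ℕ}

lemma sum_le_maxWeight {A S : Finset (Fin n)} (hA : A ⊆ S) (hc : A.card ≤ γ) :
    ∑ j ∈ A, u j ≤ maxWeight u γ S :=
  Finset.le_sup' (f := fun A => ∑ j ∈ A, u j) (by simp [hA, hc])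

variable (u γ) in
lemma exists_sum_eq_maxWeight (S : Finset (Fin n)) :
    ∃ A ⊆ S, A.card ≤ γ ∧ maxWeight u γ S = ∑ j ∈ A, u j := by
  obtain ⟨A, hA, h⟩ := Finset.exists_mem_eq_sup' (s := S.powerset.filter fun A => A.card ≤ γ)
    ⟨∅, by simp⟩ (fun A => ∑ j ∈ A, u j)
  simp only [mem_filter, mem_powerset] at hA
  exact ⟨A, hA.1, hA.2, h⟩

lemma maxWeight_nonneg (S : Finset (Fin n)) : 0 ≤ maxWeight u γ S := by
  simpa using sum_le_maxWeight (u := u) (γ := γ) (empty_subset S) (by simp)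

lemma maxWeight_mono {S T : Finset (Fin n)} (h : S ⊆ T) : maxWeight u γ S ≤ maxWeight u γ T := by
  obtain ⟨A, hA, hc, hm⟩ := exists_sum_eq_maxWeight u γ S
  exact hm ▸ sum_le_maxWeight (hA.trans h) hc

/-- The maximal weight is a submodular set function. -/
lemma maxWeight_submodular {A B : Finset (Fin n)} (h : A ⊆ B) (j : Fin n) :
    maxWeight u γ (insert j B) + maxWeight u γ A ≤
      maxWeight u γ (insert j A) + maxWeight u γ B := by
  by_cases hjA : j ∈ A
  · rw [insert_eq_of_mem hjA, insert_eq_of_mem (h hjA), add_comm]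
  obtain ⟨P, hP, hPc, hPm⟩ := exists_sum_eq_maxWeight u γ (insert j B)
  obtain ⟨Q, hQ, hQc, hQm⟩ := exists_sum_eq_maxWeight u γ A
  by_cases hjP : j ∈ P
  · have hjQ : j ∉ Q := fun hj => hjA (hQ hj)
    have hPe : P.erase j ⊆ B := by
      intro i hi
      have := hP (mem_of_mem_erase hi)
      exact (mem_insert.1 this).resolve_left (ne_of_mem_erase hi)
    have hsP : ∑ i ∈ P, u i = u j + ∑ i ∈ P.erase j, u i := (add_sum_erase _ _ hjP).symm
    have hcP := card_erase_add_one hjP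
    by_cases hlt : Q.card < γ
    · have h₁ := sum_le_maxWeight (u := u) (γ := γ) hPe (by omega)
      have h₂ := sum_le_maxWeight (u := u) (γ := γ) (insert_subset_insert j hQ)
        (by rw [card_insert_of_notMem hjQ]; omega)
      rw [sum_insert hjQ] at h₂
      linarith
    · obtain ⟨k, hkQ, hkP⟩ : ∃ k ∈ Q, k ∉ P.erase j := by
        apply exists_mem_notMem_of_card_lt_card
        omega
      have hsQ : ∑ i ∈ Q, u i = u k + ∑ i ∈ Q.erase k, u i := (add_sum_erase _ _ hkQ).symm
      have hjQ' : j ∉ Q.erase k := fun hj => hjQ (mem_of_mem_erase hj)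
      have hcQ := card_erase_add_one hkQ
      have h₁ := sum_le_maxWeight (u := u) (γ := γ) (insert_subset (h (hQ hkQ)) hPe)
        (by rw [card_insert_of_notMem hkP]; omega)
      have h₂ := sum_le_maxWeight (u := u) (γ := γ)
        (insert_subset_insert j ((erase_subset k Q).trans hQ))
        (by rw [card_insert_of_notMem hjQ']; omega)
      rw [sum_insert hkP] at h₁
      rw [sum_insert hjQ'] at h₂
      linarith
  · have h₁ := sum_le_maxWeight (u := u) (γ := γ) ((subset_insert_iff_of_notMem hjP).1 hP) hPc
    have h₂ := maxWeight_mono (u := u) (γ := γ) (subset_insert j A)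
    linarith

/-- A set of prescribed size that consists of elements of largest weight. -/
lemma exists_heaviest_subset (u : Fin n → ℝ) {T : Finset (Fin n)} {k : ℕ} (hk : k ≤ T.card) :
    ∃ A ⊆ T, A.card = k ∧ ∀ a ∈ A, ∀ b ∈ T, b ∉ A → u b ≤ u a := by
  obtain ⟨A, hA, hmax⟩ := exists_max_image (T.powersetCard k) (fun A => ∑ j ∈ A, u j)
    (powersetCard_nonempty.2 hk)
  obtain ⟨hAT, hAc⟩ := mem_powersetCard.1 hA
  refine ⟨A, hAT, hAc, fun a ha b hb hbA => ?_⟩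
  have hb' : b ∉ A.erase a := fun h => hbA (mem_of_mem_erase h)
  have hc := card_erase_add_one ha
  have hle := hmax (insert b (A.erase a)) (mem_powersetCard.2
    ⟨insert_subset hb ((erase_subset a A).trans hAT), by rw [card_insert_of_notMem hb']; omega⟩)
  rw [sum_insert hb', ← add_sum_erase A u ha] at hle
  linarith

/-- Fractional selections do not exceed the maximal weight of a set. -/
lemma sum_mul_le_maxWeight (hu : ∀ j, 0 ≤ u j) (hγ : 1 ≤ γ) {T : Finset (Fin n)} {y : Fin n → ℝ}
    (hy : ∀ j, y j ∈ Set.Icc (0 : ℝ) 1) (hT : ∀ j ∉ T, y j = 0) (hs : ∑ j, y j ≤ (γ : ℝ)) :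
    ∑ j, u j * y j ≤ maxWeight u γ T := by
  have hsum : ∑ j, u j * y j = ∑ j ∈ T, u j * y j :=
    (sum_subset (subset_univ T) fun j _ hj => by rw [hT j hj, mul_zero]).symm
  rcases le_total T.card γ with hc | hc
  · refine le_trans ?_ (sum_le_maxWeight (subset_refl T) hc)
    rw [hsum]
    exact sum_le_sum fun j _ => mul_le_of_le_one_right (hu j) (hy j).2
  · obtain ⟨A, hAT, hAc, hA⟩ := exists_heaviest_subset u hc
    obtain ⟨a, ha, hamin⟩ := exists_min_image A u (card_pos.1 (by omega))
    refine le_trans ?_ (sum_le_maxWeight hAT hAc.le)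
    -- The lightest chosen weight `u a` serves as the dual multiplier of the constraint `∑ y ≤ γ`.
    have hterm : ∀ j, u j * y j ≤ (if j ∈ A then u j - u a else 0) + u a * y j := by
      intro j
      obtain ⟨h0, h1⟩ := hy j
      split_ifs with hj
      · nlinarith [hamin j hj]
      · by_cases hjT : j ∈ T
        · nlinarith [hA a ha j hjT hj]
        · simp [hT j hjT]
    calc ∑ j, u j * y j ≤ ∑ j, ((if j ∈ A then u j - u a else 0) + u a * y j) :=
          sum_le_sum fun j _ => hterm j
      _ = ∑ j ∈ A, u j - γ * u a + u a * ∑ j, y j := by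
          simp [sum_add_distrib, ← mul_sum, hAc]
      _ ≤ ∑ j ∈ A, u j := by nlinarith [hu a]

end MaxWeight

/-! ### The map `t ↦ t / (t + c)` and incidence vectors -/

lemma div_add_le_div_add {c s t : ℝ} (hc : 0 < c) (hs : 0 ≤ s) (h : s ≤ t) :
    s / (s + c) ≤ t / (t + c) := by
  rw [div_le_div_iff₀ (by linarith) (by linarith)]
  nlinarith

/-- Decreasing differences of the concave function `t ↦ t / (t + c)`. -/
lemma div_add_sub_le {c p q r t : ℝ} (hc : 0 < c) (hp : 0 ≤ p) (hpq : p ≤ q) (hpr : p ≤ r)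
    (hrt : r ≤ t) (hqt : q ≤ t) (h : t + p ≤ q + r) :
    t / (t + c) - r / (r + c) ≤ q / (q + c) - p / (p + c) := by
  -- In this form the left difference has the smaller numerator and the larger denominator.
  have key : ∀ x y : ℝ, 0 ≤ x → 0 ≤ y →
      y / (y + c) - x / (x + c) = c * (y - x) / ((x + c) * (y + c)) := by
    intro x y hx hy
    have : x + c ≠ 0 := by linarith
    have : y + c ≠ 0 := by linarith
    field_simp
    ring
  rw [key _ _ (by linarith) (by linarith), key _ _ hp (by linarith)]
  have hpc : 0 < p + c := by linarith
  have hqc : 0 < q + c := by linarith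
  apply div_le_div₀
  · exact mul_nonneg hc.le (by linarith)
  · exact mul_le_mul_of_nonneg_left (by linarith) hc.le
  · positivity
  · exact mul_le_mul (by linarith) (by linarith) hqc.le (by linarith)

/-- The incidence vector of a set. -/
def incidence {n : ℕ} (T : Finset (Fin n)) (j : Fin n) : ℝ := if j ∈ T then 1 else 0

section Incidence

variable {n : ℕ} {T : Finset (Fin n)} {j : Fin n}

lemma incidence_of_mem (h : j ∈ T) : incidence T j = 1 := if_pos h

lemma incidence_of_notMem (h : j ∉ T) : incidence T j = 0 := if_neg h

lemma incidence_congr {T' : Finset (Fin n)} (h : j ∈ T ↔ j ∈ T') :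
    incidence T j = incidence T' j := by
  simp only [incidence, h]

lemma exists_eq_incidence {x : Fin n → ℝ} (hx : ∀ j, x j = 0 ∨ x j = 1) :
    ∃ T : Finset (Fin n), x = incidence T := by
  classical
  refine ⟨univ.filter fun j => x j = 1, funext fun j => ?_⟩
  rcases hx j with h | h <;> simp [incidence, h]

end Incidence

/-! ### Submodularity of `Φ` and the seed inequalities -/

section Phi

variable {n : ℕ} {u₀ : ℝ} {u : Fin n → ℝ} {γ : ℕ}

lemma Phi_eq_maxWeight (hu₀ : 0 < u₀) (hu : ∀ j, 0 ≤ u j) (S : Finset (Fin n)) :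
    Phi u₀ u γ S = maxWeight u γ S / (maxWeight u γ S + u₀) := by
  apply le_antisymm
  · refine Finset.sup'_le _ _ fun A hA => ?_
    simp only [mem_filter, mem_powerset] at hA
    exact div_add_le_div_add hu₀ (sum_nonneg fun j _ => hu j) (sum_le_maxWeight hA.1 hA.2)
  · obtain ⟨A, hA, hc, hm⟩ := exists_sum_eq_maxWeight u γ S
    rw [hm]
    exact Finset.le_sup' (share u₀ u) (by simp [hA, hc])

/-- Submodularity of `Φ`. -/
lemma rho_anti (hu₀ : 0 < u₀) (hu : ∀ j, 0 ≤ u j) {A B : Finset (Fin n)} (h : A ⊆ B) (j : Fin n) :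
    rho u₀ u γ j B ≤ rho u₀ u γ j A := by
  simp only [rho, Phi_eq_maxWeight hu₀ hu]
  exact div_add_sub_le hu₀ (maxWeight_nonneg A) (maxWeight_mono (subset_insert j A))
    (maxWeight_mono h) (maxWeight_mono (subset_insert j B))
    (maxWeight_mono (insert_subset_insert j h)) (maxWeight_submodular h j)

/-- The linear relaxation is integral: a heaviest admissible subset of `T` is as good as any
fractional selection. -/
lemma phi_incidence (hu₀ : 0 < u₀) (hu : ∀ j, 0 ≤ u j) (hγ : 1 ≤ γ) (T : Finset (Fin n)) :
    phi u₀ u γ (incidence T) = Phi u₀ u γ T := by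
  rw [Phi_eq_maxWeight hu₀ hu]
  refine IsGreatest.csSup_eq ⟨?_, ?_⟩
  · obtain ⟨A, hA, hc, hm⟩ := exists_sum_eq_maxWeight u γ T
    refine ⟨incidence A, ?_, fun j => ?_, fun j => ?_, ?_⟩
    · simpa [incidence] using hc
    · by_cases hj : j ∈ A
      · rw [incidence_of_mem hj, incidence_of_mem (hA hj)]
      · rw [incidence_of_notMem hj, incidence]
        split_ifs <;> norm_num
    · rw [incidence]
      split_ifs <;> norm_num
    · simp [incidence, hm]
  · rintro r ⟨y, hs, hle, hy, rfl⟩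
    refine div_add_le_div_add hu₀ (sum_nonneg fun j _ => mul_nonneg (hu j) (hy j).1)
      (sum_mul_le_maxWeight hu hγ hy (fun j hj => ?_) hs)
    exact le_antisymm (incidence_of_notMem hj ▸ hle j) (hy j).1

/-- Adding the elements of `R` one by one, each gains at most what it would gain at `S`. -/
lemma Phi_union_le (hu₀ : 0 < u₀) (hu : ∀ j, 0 ≤ u j) (S R : Finset (Fin n)) :
    Phi u₀ u γ (S ∪ R) ≤ Phi u₀ u γ S + ∑ j ∈ R, rho u₀ u γ j S := by
  induction R using Finset.induction_on with
  | empty => simp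
  | insert a R ha ih =>
    have h := rho_anti (γ := γ) hu₀ hu (subset_union_left (s₁ := S) (s₂ := R)) a
    rw [rho] at h
    rw [union_insert, sum_insert ha]
    linarith

/-- Removing the elements of `R` one by one, each loses at least its marginal gain at `S.erase j`,
since the set left after its removal lies in `S.erase j`. -/
lemma Phi_sdiff_le (hu₀ : 0 < u₀) (hu : ∀ j, 0 ≤ u j) (S R : Finset (Fin n)) (hR : R ⊆ S) :
    Phi u₀ u γ (S \ R) ≤ Phi u₀ u γ S - ∑ j ∈ R, rho u₀ u γ j (S.erase j) := by
  induction R using Finset.induction_on with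
  | empty => simp
  | insert a R ha ih =>
    have ih := ih ((subset_insert a R).trans hR)
    have haS : a ∈ S := hR (mem_insert_self a R)
    have hsub : S \ insert a R ⊆ S.erase a := by
      intro i
      simp only [mem_sdiff, mem_insert, mem_erase]
      tauto
    have hins : insert a (S \ insert a R) = S \ R := by
      ext i
      simp only [mem_sdiff, mem_insert]
      by_cases hi : i = a
      · subst hi; simp [haS, ha]
      · simp [hi]
    have h := rho_anti (γ := γ) hu₀ hu hsub a
    rw [rho.eq_def u₀ u γ a (S \ insert a R), hins] at h
    rw [sum_insert ha]
    linarith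

/-- The seed inequality for down-lifting holds at all supersets of `S`. -/
lemma Phi_le_of_superset (hu₀ : 0 < u₀) (hu : ∀ j, 0 ≤ u j) {S T : Finset (Fin n)} (h : S ⊆ T) :
    Phi u₀ u γ T ≤ Phi u₀ u γ S + ∑ j ∈ Sᶜ, rho u₀ u γ j S * incidence T j := by
  have key := Phi_union_le (γ := γ) hu₀ hu S (T \ S)
  rw [union_sdiff_of_subset h] at key
  refine key.trans_eq ?_
  congr 1
  simp only [incidence, mul_ite, mul_one, mul_zero, ← sum_filter]
  exact sum_congr (by ext i; simp [and_comm]) fun _ _ => rfl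

/-- The seed inequality for up-lifting holds at all subsets of `S`. -/
lemma Phi_le_of_subset (hu₀ : 0 < u₀) (hu : ∀ j, 0 ≤ u j) {S T : Finset (Fin n)} (h : T ⊆ S) :
    Phi u₀ u γ T ≤
      Phi u₀ u γ S - ∑ j ∈ S, rho u₀ u γ j (S.erase j) * (1 - incidence T j) := by
  have key := Phi_sdiff_le (γ := γ) hu₀ hu S (S \ T) sdiff_subset
  rw [Finset.sdiff_sdiff_eq_self h] at key
  refine key.trans_eq ?_
  congr 1
  have : ∀ j, 1 - incidence T j = if j ∉ T then 1 else 0 := by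
    intro j
    by_cases hj : j ∈ T <;> simp [incidence, hj]
  simp only [this, mul_ite, mul_one, mul_zero, ← sum_filter]
  exact sum_congr (by ext i; simp) fun _ _ => rfl

end Phi

/-! ### Lifting problems as finite maximizations -/

section LiftingProblem

variable {n : ℕ} {u₀ : ℝ} {u : Fin n → ℝ} {γ : ℕ}

lemma mem_XFix_incidence (hu₀ : 0 < u₀) (hu : ∀ j, 0 ≤ u j) (hγ : 1 ≤ γ)
    {S₀ S₁ T : Finset (Fin n)} (h₀ : Disjoint S₀ T) (h₁ : S₁ ⊆ T) :
    (Phi u₀ u γ T, incidence T) ∈ XFix u₀ u γ S₀ S₁ := by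
  refine ⟨⟨fun j => ?_, (phi_incidence hu₀ hu hγ T).ge⟩,
    fun j hj => incidence_of_notMem (disjoint_left.1 h₀ hj), fun j hj => incidence_of_mem (h₁ hj)⟩
  by_cases hj : j ∈ T
  · exact Or.inr (incidence_of_mem hj)
  · exact Or.inl (incidence_of_notMem hj)

lemma exists_of_mem_XFix (hu₀ : 0 < u₀) (hu : ∀ j, 0 ≤ u j) (hγ : 1 ≤ γ)
    {S₀ S₁ : Finset (Fin n)} {p : ℝ × (Fin n → ℝ)} (hp : p ∈ XFix u₀ u γ S₀ S₁) :
    ∃ T, Disjoint S₀ T ∧ S₁ ⊆ T ∧ p.2 = incidence T ∧ p.1 ≤ Phi u₀ u γ T := by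
  obtain ⟨⟨hx, hw⟩, h₀, h₁⟩ := hp
  obtain ⟨T, hT⟩ := exists_eq_incidence hx
  rw [hT] at h₀ h₁ hw
  refine ⟨T, disjoint_left.2 fun j hj hjT => ?_, fun j hj => ?_, hT,
    hw.trans_eq (phi_incidence hu₀ hu hγ T)⟩
  · have := h₀ j hj
    rw [incidence_of_mem hjT] at this
    exact one_ne_zero this
  · by_contra hjT
    have := h₁ j hj
    rw [incidence_of_notMem hjT] at this
    exact zero_ne_one this

/-- Lifting problems over `𝒳(S₀, S₁)` attain their maximum. -/
lemma exists_isGreatest_XFix (hu₀ : 0 < u₀) (hu : ∀ j, 0 ≤ u j) (hγ : 1 ≤ γ)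
    {S₀ S₁ : Finset (Fin n)} (hd : Disjoint S₀ S₁) (f g : (Fin n → ℝ) → ℝ) :
    ∃ ν, IsGreatest ((fun p : ℝ × (Fin n → ℝ) => p.1 - f p.2 - g p.2) '' XFix u₀ u γ S₀ S₁) ν := by
  obtain ⟨T, hT, hmax⟩ := exists_max_image (univ.filter fun T => Disjoint S₀ T ∧ S₁ ⊆ T)
    (fun T => Phi u₀ u γ T - f (incidence T) - g (incidence T)) ⟨S₁, by simp [hd]⟩
  simp only [mem_filter, mem_univ, true_and] at hT hmax
  refine ⟨_, ⟨_, mem_XFix_incidence hu₀ hu hγ hT.1 hT.2, rfl⟩, ?_⟩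
  rintro _ ⟨p, hp, rfl⟩
  obtain ⟨R, h₀, h₁, h₂, h₃⟩ := exists_of_mem_XFix hu₀ hu hγ hp
  have := hmax R ⟨h₀, h₁⟩
  simp only [h₂]
  linarith

end LiftingProblem

/-! ### Recursion and last positions along an ordering -/

/-- A recursion in which the value at `i` depends only on the values at smaller indices has exactly
one solution. -/
lemma existsUnique_of_recursion {m : ℕ} {α : Type*} [Nonempty α] (F : Fin m → (Fin m → α) → α)
    (hF : ∀ i f g, (∀ k < i, f k = g k) → F i f = F i g) :
    ∃! f : Fin m → α, ∀ i, f i = F i f := by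
  classical
  obtain ⟨a⟩ := ‹Nonempty α›
  -- The filler `a` at indices not below `i` is harmless, because `F i` ignores those values.
  let f : Fin m → α := WellFounded.fix (C := fun _ => α) (wellFounded_lt (α := Fin m))
    fun i r => F i fun k => if h : k < i then r k h else a
  have hf : ∀ i, f i = F i f := fun i => by
    refine (WellFounded.fix_eq _ _ i).trans (hF i _ _ fun k hk => ?_)
    simp only [hk, dite_true]
    rfl
  refine ⟨f, hf, fun g hg => funext fun i => ?_⟩
  induction i using WellFoundedLT.induction with
  | ind i ih => rw [hg i, hf i]; exact hF i _ _ ih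

lemma existsUnique_comp_equiv {ι κ α : Type*} (σ : ι ≃ κ) {P : (ι → α) → Prop}
    (h : ∃! f, P f) : ∃! g : κ → α, P (g ∘ σ) := by
  obtain ⟨f, hf, huniq⟩ := h
  refine ⟨f ∘ σ.symm, by simpa [Function.comp_assoc] using hf, fun g hg => ?_⟩
  rw [← huniq _ hg, Function.comp_assoc, Equiv.self_comp_symm, Function.comp_id]

lemma sum_eq_add_sum_Iio {m : ℕ} (f : Fin m → ℝ) (k : Fin m) (h : ∀ i, k < i → f i = 0) :
    ∑ i, f i = f k + ∑ i ∈ Iio k, f i := by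
  rw [← sum_insert (by simp), Iio_insert]
  exact (sum_subset (subset_univ _) fun i _ hi => h i (by simpa using hi)).symm

lemma exists_last_or_forall_not {m : ℕ} (p : Fin m → Prop) :
    (∀ i, ¬ p i) ∨ ∃ k, p k ∧ ∀ i, k < i → ¬ p i := by
  classical
  by_cases h : ∃ i, p i
  · obtain ⟨i, hi⟩ := h
    obtain ⟨k, hk, hmax⟩ := exists_max_image (univ.filter p) id ⟨i, by simpa using hi⟩
    refine Or.inr ⟨k, by simpa using hk, fun i hki hi => ?_⟩
    exact absurd (hmax i (by simpa using hi)) (not_le.2 hki)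
  · exact Or.inl (not_exists.1 h)

/-! ### Down-lifting -/

section Down

variable {n : ℕ} {u₀ : ℝ} {u : Fin n → ℝ} {γ : ℕ} {S : Finset (Fin n)} {σ : Fin S.card ≃ ↥S}

lemma existsUnique_isDownLifting (hu₀ : 0 < u₀) (hu : ∀ j, 0 ≤ u j) (hγ : 1 ≤ γ) :
    ∃! η : ↥S → ℝ, IsDownLifting u₀ u γ S σ η := by
  let V (ℓ : Fin S.card) (f : Fin S.card → ℝ) : Set ℝ :=
    (fun p : ℝ × (Fin n → ℝ) => p.1 - ∑ j ∈ Sᶜ, rho u₀ u γ j S * p.2 j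
      - ∑ τ ∈ Finset.Iio ℓ, f τ * p.2 (σ τ)) ''
        XFix u₀ u γ {(σ ℓ : Fin n)} ((Finset.Ioi ℓ).image fun τ => (σ τ : Fin n))
  -- Since the maximum is attained for arbitrary coefficients, `sSup` can replace the existential
  -- `ν` and turn the definition into an explicit recursion.
  have hV : ∀ ℓ f, IsGreatest (V ℓ f) (sSup (V ℓ f)) := by
    intro ℓ f
    obtain ⟨ν, hν⟩ := exists_isGreatest_XFix hu₀ hu hγ
      (S₀ := {(σ ℓ : Fin n)}) (S₁ := (Finset.Ioi ℓ).image fun τ => (σ τ : Fin n))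
      (by
        rw [disjoint_singleton_left]
        intro h
        obtain ⟨τ, hτ, h⟩ := mem_image.1 h
        rw [Subtype.coe_inj, σ.injective.eq_iff] at h
        exact absurd h (mem_Ioi.1 hτ).ne')
      (fun x => ∑ j ∈ Sᶜ, rho u₀ u γ j S * x j) (fun x => ∑ τ ∈ Finset.Iio ℓ, f τ * x (σ τ))
    have hν : IsGreatest (V ℓ f) ν := hν
    rwa [hν.csSup_eq]
  have hrec := existsUnique_comp_equiv σ (existsUnique_of_recursion
    (fun ℓ f => Phi u₀ u γ S - ∑ τ ∈ Finset.Iio ℓ, f τ - sSup (V ℓ f))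
    (by
      intro ℓ f g hfg
      have h₁ : ∑ τ ∈ Finset.Iio ℓ, f τ = ∑ τ ∈ Finset.Iio ℓ, g τ :=
        sum_congr rfl fun τ hτ => hfg τ (mem_Iio.1 hτ)
      have h₂ : V ℓ f = V ℓ g := by
        refine Set.image_congr fun p _ => ?_
        congr 1
        exact sum_congr rfl fun τ hτ => by rw [hfg τ (mem_Iio.1 hτ)]
      rw [h₁, h₂]))
  refine (existsUnique_congr fun η => ?_).1 hrec
  refine forall_congr' fun ℓ => ⟨fun h => ⟨_, hV ℓ (η ∘ σ), h⟩, ?_⟩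
  rintro ⟨ν, hν, h⟩
  have hν : IsGreatest (V ℓ (η ∘ σ)) ν := hν
  rw [hν.csSup_eq]
  exact h

variable {η : ↥S → ℝ}

/-- The down-lifted inequality is valid. -/
lemma liftedSI1_incidence (hu₀ : 0 < u₀) (hu : ∀ j, 0 ≤ u j) (hγ : 1 ≤ γ)
    (hη : IsDownLifting u₀ u γ S σ η) (T : Finset (Fin n)) :
    LiftedSI1 u₀ u γ S η (Phi u₀ u γ T) (incidence T) := by
  rw [LiftedSI1, ← σ.sum_comp]
  rcases exists_last_or_forall_not fun τ => (σ τ : Fin n) ∉ T with h | ⟨ℓ, hℓ, hlast⟩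
  · have hsub : S ⊆ T := fun j hj => by
      have := not_not.1 (h (σ.symm ⟨j, hj⟩))
      simpa using this
    have hz : ∑ τ, η (σ τ) * (1 - incidence T (σ τ)) = 0 :=
      sum_eq_zero fun τ _ => by rw [incidence_of_mem (not_not.1 (h τ))]; ring
    have := Phi_le_of_superset (γ := γ) hu₀ hu hsub
    rw [hz]
    linarith
  · obtain ⟨ν, hν, hηℓ⟩ := hη ℓ
    -- By the choice of `ℓ`, all later elements lie in `T`: so `T` is feasible for problem `ℓ`, and
    -- their terms vanish from the lifted inequality.
    have hle := hν.2 ⟨_, mem_XFix_incidence hu₀ hu hγ (T := T)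
      (disjoint_singleton_left.2 hℓ) (fun j hj => by
        obtain ⟨τ, hτ, rfl⟩ := mem_image.1 hj
        exact not_not.1 (hlast τ (mem_Ioi.1 hτ))), rfl⟩
    rw [sum_eq_add_sum_Iio _ ℓ fun τ hτ => by
      rw [incidence_of_mem (not_not.1 (hlast τ hτ))]; ring, incidence_of_notMem hℓ]
    simp only [mul_sub, mul_one, sum_sub_distrib]
    simp only at hle
    linarith

lemma rho_le_of_isDownLifting (hu₀ : 0 < u₀) (hu : ∀ j, 0 ≤ u j) (hγ : 1 ≤ γ)
    (hη : IsDownLifting u₀ u γ S σ η) (j : ↥S) :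
    rho u₀ u γ j (univ.erase (j : Fin n)) ≤ η j := by
  obtain ⟨ℓ, rfl⟩ := σ.surjective j
  obtain ⟨ν, ⟨⟨p, hp, hpν⟩, -⟩, hηℓ⟩ := hη ℓ
  obtain ⟨T, h₀, h₁, hx, hw⟩ := exists_of_mem_XFix hu₀ hu hγ hp
  have hℓ : (σ ℓ : Fin n) ∉ T := disjoint_singleton_left.1 h₀
  -- Only the term of `σ ℓ` changes between `T` and this set, so validity here and optimality of `T`
  -- leave `η (σ ℓ)` at least the gain of `σ ℓ` at `T`.
  have hvalid := liftedSI1_incidence hu₀ hu hγ hη (insert (σ ℓ : Fin n) T)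
  rw [LiftedSI1, ← σ.sum_comp, sum_eq_add_sum_Iio _ ℓ, incidence_of_mem (mem_insert_self _ _)]
    at hvalid
  · have hρ := rho_anti (γ := γ) hu₀ hu (A := T) (B := univ.erase (σ ℓ : Fin n))
      (fun i hi => mem_erase.2 ⟨fun h => hℓ (h ▸ hi), mem_univ i⟩) (σ ℓ)
    rw [rho.eq_def u₀ u γ (σ ℓ) T] at hρ
    have e₁ : ∑ j ∈ Sᶜ, rho u₀ u γ j S * incidence (insert (σ ℓ : Fin n) T) j =
        ∑ j ∈ Sᶜ, rho u₀ u γ j S * incidence T j := by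
      refine sum_congr rfl fun i hi => ?_
      rw [incidence_congr (T' := T)]
      exact mem_insert.trans (or_iff_right fun h => mem_compl.1 hi (h ▸ (σ ℓ).2))
    have e₂ : ∑ τ ∈ Iio ℓ, η (σ τ) * (1 - incidence (insert (σ ℓ : Fin n) T) (σ τ)) =
        ∑ τ ∈ Iio ℓ, η (σ τ) * (1 - incidence T (σ τ)) := by
      refine sum_congr rfl fun τ hτ => ?_
      rw [incidence_congr (T' := T)]
      refine mem_insert.trans (or_iff_right fun h => (mem_Iio.1 hτ).ne ?_)
      exact σ.injective (Subtype.ext h)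
    rw [e₁, e₂] at hvalid
    simp only [mul_sub, mul_one, sum_sub_distrib] at hvalid
    simp only [hx] at hpν
    linarith
  · intro τ hτ
    rw [incidence_of_mem (mem_insert_of_mem (h₁ (mem_image_of_mem _ (mem_Ioi.2 hτ))))]
    ring

lemma liftedSI1_atLeastAsStrong
    (h : ∀ j : ↥S, rho u₀ u γ j (univ.erase (j : Fin n)) ≤ η j) :
    AtLeastAsStrong (LiftedSI1 u₀ u γ S η) (SI1 u₀ u γ S) := by
  intro w x hx hw
  rw [LiftedSI1] at hw
  rw [SI1, ← sum_coe_sort S]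
  have : ∑ j : ↥S, rho u₀ u γ j (univ.erase (j : Fin n)) * (1 - x j) ≤
      ∑ j : ↥S, η j * (1 - x j) :=
    sum_le_sum fun j _ => mul_le_mul_of_nonneg_right (h j) (sub_nonneg.2 (hx j).2)
  linarith

end Down

/-! ### Up-lifting -/

section Up

variable {n : ℕ} {u₀ : ℝ} {u : Fin n → ℝ} {γ : ℕ} {S : Finset (Fin n)}
  {σ : Fin (Sᶜ).card ≃ ↥(Sᶜ)}

lemma existsUnique_isUpLifting (hu₀ : 0 < u₀) (hu : ∀ j, 0 ≤ u j) (hγ : 1 ≤ γ) :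
    ∃! ζ : ↥(Sᶜ) → ℝ, IsUpLifting u₀ u γ S σ ζ := by
  let V (ℓ : Fin (Sᶜ).card) (f : Fin (Sᶜ).card → ℝ) : Set ℝ :=
    (fun p : ℝ × (Fin n → ℝ) => p.1 - ∑ j ∈ S, rho u₀ u γ j (S.erase j) * p.2 j
      - ∑ τ ∈ Finset.Iio ℓ, f τ * p.2 (σ τ)) ''
        XFix u₀ u γ ((Finset.Ioi ℓ).image fun τ => (σ τ : Fin n)) {(σ ℓ : Fin n)}
  have hV : ∀ ℓ f, IsGreatest (V ℓ f) (sSup (V ℓ f)) := by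
    intro ℓ f
    obtain ⟨ν, hν⟩ := exists_isGreatest_XFix hu₀ hu hγ
      (S₀ := (Finset.Ioi ℓ).image fun τ => (σ τ : Fin n)) (S₁ := {(σ ℓ : Fin n)})
      (by
        rw [disjoint_singleton_right]
        intro h
        obtain ⟨τ, hτ, h⟩ := mem_image.1 h
        rw [Subtype.coe_inj, σ.injective.eq_iff] at h
        exact absurd h (mem_Ioi.1 hτ).ne')
      (fun x => ∑ j ∈ S, rho u₀ u γ j (S.erase j) * x j)
      (fun x => ∑ τ ∈ Finset.Iio ℓ, f τ * x (σ τ))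
    have hν : IsGreatest (V ℓ f) ν := hν
    rwa [hν.csSup_eq]
  have hrec := existsUnique_comp_equiv σ (existsUnique_of_recursion
    (fun ℓ f => -Phi u₀ u γ S + ∑ j ∈ S, rho u₀ u γ j (S.erase j) + sSup (V ℓ f))
    (by
      intro ℓ f g hfg
      have h₂ : V ℓ f = V ℓ g := by
        refine Set.image_congr fun p _ => ?_
        congr 1
        exact sum_congr rfl fun τ hτ => by rw [hfg τ (mem_Iio.1 hτ)]
      rw [h₂]))
  refine (existsUnique_congr fun ζ => ?_).1 hrec
  refine forall_congr' fun ℓ => ⟨fun h => ⟨_, hV ℓ (ζ ∘ σ), h⟩, ?_⟩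
  rintro ⟨ν, hν, h⟩
  have hν : IsGreatest (V ℓ (ζ ∘ σ)) ν := hν
  rw [hν.csSup_eq]
  exact h

variable {ζ : ↥(Sᶜ) → ℝ}

/-- The up-lifted inequality is valid. -/
lemma liftedSI2_incidence (hu₀ : 0 < u₀) (hu : ∀ j, 0 ≤ u j) (hγ : 1 ≤ γ)
    (hζ : IsUpLifting u₀ u γ S σ ζ) (T : Finset (Fin n)) :
    LiftedSI2 u₀ u γ S ζ (Phi u₀ u γ T) (incidence T) := by
  rw [LiftedSI2, ← σ.sum_comp]
  rcases exists_last_or_forall_not fun τ => (σ τ : Fin n) ∈ T with h | ⟨ℓ, hℓ, hlast⟩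
  · have hsub : T ⊆ S := fun j hj => by
      by_contra hjS
      have := h (σ.symm ⟨j, mem_compl.2 hjS⟩)
      simp [hj] at this
    have hz : ∑ τ, ζ (σ τ) * incidence T (σ τ) = 0 :=
      sum_eq_zero fun τ _ => by rw [incidence_of_notMem (h τ)]; ring
    have := Phi_le_of_subset (γ := γ) hu₀ hu hsub
    rw [hz]
    linarith
  · obtain ⟨ν, hν, hζℓ⟩ := hζ ℓ
    have hle := hν.2 ⟨_, mem_XFix_incidence hu₀ hu hγ (T := T)
      (disjoint_left.2 fun j hj => by
        obtain ⟨τ, hτ, rfl⟩ := mem_image.1 hj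
        exact hlast τ (mem_Ioi.1 hτ)) (singleton_subset_iff.2 hℓ), rfl⟩
    rw [sum_eq_add_sum_Iio _ ℓ fun τ hτ => by
      rw [incidence_of_notMem (hlast τ hτ)]; ring, incidence_of_mem hℓ]
    simp only [mul_sub, mul_one, sum_sub_distrib]
    simp only at hle
    linarith

lemma le_rho_of_isUpLifting (hu₀ : 0 < u₀) (hu : ∀ j, 0 ≤ u j) (hγ : 1 ≤ γ)
    (hζ : IsUpLifting u₀ u γ S σ ζ) (j : ↥(Sᶜ)) : ζ j ≤ rho u₀ u γ j ∅ := by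
  obtain ⟨ℓ, rfl⟩ := σ.surjective j
  obtain ⟨ν, ⟨⟨p, hp, hpν⟩, -⟩, hζℓ⟩ := hζ ℓ
  obtain ⟨T, h₀, h₁, hx, hw⟩ := exists_of_mem_XFix hu₀ hu hγ hp
  have hℓ : (σ ℓ : Fin n) ∈ T := singleton_subset_iff.1 h₁
  -- Here the flip is a deletion: `ζ (σ ℓ)` is at most the gain of `σ ℓ` at `T.erase (σ ℓ)`, hence
  -- at most its gain at `∅`.
  have hvalid := liftedSI2_incidence hu₀ hu hγ hζ (T.erase (σ ℓ : Fin n))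
  rw [LiftedSI2, ← σ.sum_comp, sum_eq_add_sum_Iio _ ℓ, incidence_of_notMem (notMem_erase _ _)]
    at hvalid
  · have hρ := rho_anti (γ := γ) hu₀ hu (empty_subset (T.erase (σ ℓ : Fin n))) (σ ℓ)
    rw [rho.eq_def u₀ u γ (σ ℓ) (T.erase _), insert_erase hℓ] at hρ
    have e₁ : ∑ j ∈ S, rho u₀ u γ j (S.erase j) * (1 - incidence (T.erase (σ ℓ : Fin n)) j) =
        ∑ j ∈ S, rho u₀ u γ j (S.erase j) * (1 - incidence T j) := by
      refine sum_congr rfl fun i hi => ?_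
      rw [incidence_congr (T' := T)]
      exact mem_erase.trans (and_iff_right fun h => mem_compl.1 (σ ℓ).2 (h ▸ hi))
    have e₂ : ∑ τ ∈ Iio ℓ, ζ (σ τ) * incidence (T.erase (σ ℓ : Fin n)) (σ τ) =
        ∑ τ ∈ Iio ℓ, ζ (σ τ) * incidence T (σ τ) := by
      refine sum_congr rfl fun τ hτ => ?_
      rw [incidence_congr (T' := T)]
      refine mem_erase.trans (and_iff_right fun h => (mem_Iio.1 hτ).ne ?_)
      exact σ.injective (Subtype.ext h)
    rw [e₁, e₂] at hvalid
    simp only [mul_sub, mul_one, sum_sub_distrib] at hvalid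
    simp only [hx] at hpν
    linarith
  · intro τ hτ
    rw [incidence_of_notMem fun h => disjoint_left.1 h₀ (mem_image_of_mem _ (mem_Ioi.2 hτ))
      (mem_of_mem_erase h), mul_zero]

lemma liftedSI2_atLeastAsStrong (h : ∀ j : ↥(Sᶜ), ζ j ≤ rho u₀ u γ j ∅) :
    AtLeastAsStrong (LiftedSI2 u₀ u γ S ζ) (SI2 u₀ u γ S) := by
  intro w x hx hw
  rw [LiftedSI2] at hw
  rw [SI2, ← sum_coe_sort Sᶜ]
  have : ∑ j : ↥(Sᶜ), ζ j * x j ≤ ∑ j : ↥(Sᶜ), rho u₀ u γ j ∅ * x j :=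
    sum_le_sum fun j _ => mul_le_mul_of_nonneg_right (h j) (hx j).1
  linarith

end Up

end LiftedSubmodular

theorem corollary5 (n : ℕ) (u₀ : ℝ) (hu₀ : 0 < u₀) (u : Fin n → ℝ) (hu : ∀ j, 0 ≤ u j)
    (γ : ℕ) (hγ : 1 ≤ γ) (S : Finset (Fin n)) :
    (∀ σ : Fin S.card ≃ ↥S,
      (∃! η : ↥S → ℝ, LiftedSubmodular.IsDownLifting u₀ u γ S σ η) ∧
      ∀ η : ↥S → ℝ, LiftedSubmodular.IsDownLifting u₀ u γ S σ η →
        (∀ j : ↥S, LiftedSubmodular.rho u₀ u γ j (Finset.univ.erase (j : Fin n)) ≤ η j) ∧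
        LiftedSubmodular.AtLeastAsStrong
          (LiftedSubmodular.LiftedSI1 u₀ u γ S η) (LiftedSubmodular.SI1 u₀ u γ S)) ∧
    (∀ σ : Fin (Sᶜ).card ≃ ↥(Sᶜ),
      (∃! ζ : ↥(Sᶜ) → ℝ, LiftedSubmodular.IsUpLifting u₀ u γ S σ ζ) ∧
      ∀ ζ : ↥(Sᶜ) → ℝ, LiftedSubmodular.IsUpLifting u₀ u γ S σ ζ →
        (∀ j : ↥(Sᶜ), ζ j ≤ LiftedSubmodular.rho u₀ u γ j ∅) ∧
        LiftedSubmodular.AtLeastAsStrong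
          (LiftedSubmodular.LiftedSI2 u₀ u γ S ζ) (LiftedSubmodular.SI2 u₀ u γ S)) := by
  refine ⟨fun σ => ⟨LiftedSubmodular.existsUnique_isDownLifting hu₀ hu hγ, fun η hη => ?_⟩,
    fun σ => ⟨LiftedSubmodular.existsUnique_isUpLifting hu₀ hu hγ, fun ζ hζ => ?_⟩⟩
  · have h := LiftedSubmodular.rho_le_of_isDownLifting hu₀ hu hγ hη
    exact ⟨h, LiftedSubmodular.liftedSI1_atLeastAsStrong h⟩
  · have h := LiftedSubmodular.le_rho_of_isUpLifting hu₀ hu hγ hζ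
    exact ⟨h, LiftedSubmodular.liftedSI2_atLeastAsStrong h⟩
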